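/- Let $\Sigma$ be a finite alphabet with at least two letters. A pushdown automaton (PDA) over $\Sigma$ has finitely many states and stack symbols; in one nondeterministic move it reads at most one input letter, pops at most one stack symbol and pushes at most one stack symbol. It starts with an empty stack and accepts by final state after reading the whole input. Its size is the number of its states plus the number of its stack symbols. For $m\in\mathbb N$ let $W_m=\{ww : w\in\Sigma^*,\ |w|=m\}$, and for $n\in\mathbb N$ let $A_n=\Sigma^*\setminus W_{2^n}$. There are real constants $c,C>0$, depending only on $\Sigma$, such that for all but finitely many $n$ the following hold. 1. $A_n$ is cofinite in $\Sigma^*$, and both $A_n$ and $\overline{A_n}=\Sigma^*\setminus A_n$ are recognized by PDAs. 2. Every PDA (in particular, every deterministic PDA) that recognizes $\overline{A_n}$ has size at least $2^{2^{cn}}$. 3. Some PDA of size at most $Cn$ recognizes $A_n$. -/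

import Mathlib

universe u

/-- A (nondeterministic) pushdown automaton over the input alphabet `α`. In one move it reads at
most one input letter, pops at most one stack symbol and pushes at most one stack symbol
(`none` stands for the empty word in each case). The stack is initially empty. -/
structure PDA (α : Type u) where
  /-- The states. -/
  State : Type
  /-- The stack alphabet. -/
  Stack : Type
  finite_state : Finite State
  finite_stack : Finite Stack
  /-- The initial state. -/
  start : State
  /-- The accepting states. -/
  accept : Set State
  /-- `(p, y) ∈ trans q a x`: in state `q`, reading `a` and popping `x`, the automaton may go to
  state `p` and push `y`. -/
  trans : State → Option α → Option Stack → Set (State × Option Stack)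

namespace PDA

variable {α : Type u}

/-- A configuration: the state, the unread input, and the stack (top symbol first). -/
abbrev Config (M : PDA α) : Type u := M.State × List α × List M.Stack

/-- One move of the automaton. -/
inductive Step (M : PDA α) : M.Config → M.Config → Prop
  | move {q p : M.State} {a : Option α} {x y : Option M.Stack} (h : (p, y) ∈ M.trans q a x)
      (w : List α) (s : List M.Stack) :
      Step M (q, a.toList ++ w, x.toList ++ s) (p, w, y.toList ++ s)

/-- The language recognized by `M`: the words that some run reads completely, ending in an
accepting state (with any stack). -/
def language (M : PDA α) : Language α :=
  {w | ∃ q ∈ M.accept, ∃ s : List M.Stack,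
    Relation.ReflTransGen M.Step (M.start, w, []) (q, [], s)}

/-- The size: the number of states plus the number of stack symbols. -/
noncomputable def size (M : PDA α) : ℕ := Nat.card M.State + Nat.card M.Stack

end PDA

/-- `L(PDA)`: the languages recognized by some pushdown automaton. -/
def IsPDALanguage {α : Type u} (L : Language α) : Prop := ∃ M : PDA α, M.language = L

/-- `W_m = {ww : |w| = m}`. -/
def squares (α : Type u) (m : ℕ) : Language α :=
  {x | ∃ w : List α, w.length = m ∧ x = w ++ w}

/-- `A_n`, the complement of `W_m` for `m = 2 ^ n`. -/
def scaledNonSquares (α : Type u) (n : ℕ) : Language α := (squares α (2 ^ n))ᶜ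

/-!
A word fails to be a square of length `2 * m`, `m = 2 ^ n`, if and only if it has the wrong length
or has two different letters at distance `m`. A pushdown automaton can guess which of these happens,
and where, and then it only has to count to `2 ^ n` or `2 ^ (n + 1)`. Counting is cheap: to read
`2 ^ (j + 1)` letters, push a symbol `block j`, read `2 ^ j` letters, pop the symbol and read `2 ^ j`
letters again. This takes `O(n)` states and stack symbols (`nonSquarePDA`, with
`nonSquarePDA_language` and `nonSquarePDA_size_le`).

For the lower bound, the runs of an automaton `M` are generated by a grammar with at most
`2 * M.size ^ 4` nonterminals (`PDA.mem_language_iff_derives`, `PDA.card_nonterminal_le`). Hence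
every accepted word of length `2 * m` contains a factor of length between `m / 2` and `m`
that may be exchanged for any other word generated by the same nonterminal
(`PDA.Derives.exists_factor`). But a factor of length at most `m` of a square is determined by the
rest of the square (`eq_of_append_mem_squares`). So two squares with the same nonterminal at the same
place have the same factor there, and counting the squares shows that the number of nonterminals is
exponential in `m` (`PDA.pow_le_of_language_eq_squares`).
-/

/-! ### A grammar for the runs of a pushdown automaton -/

namespace PDA

variable {α : Type u}

/-- The nonterminals of a grammar attached to `M`. The symbol `(p, x, q, y)` stands for the words
that take `M` from state `p` to state `q` and turn the stack top `x` into `y` without looking below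
it (`none` is the empty top). The symbol `q` alone stands for the words that take `M` from its
initial configuration to state `q`, with any stack. -/
abbrev Nonterminal (M : PDA α) : Type :=
  (M.State × Option M.Stack × M.State × Option M.Stack) ⊕ M.State

/-- `M.Derives A u`: the word `u` is generated by the nonterminal `A`. Every rule has at most two
nonterminals on its right-hand side, and terminal rules produce at most one letter, which is what
`Derives.exists_factor` needs. In `extend` the symbol `y` is pushed and never looked at again. -/
inductive Derives (M : PDA α) : M.Nonterminal → List α → Prop
  | refl (p : M.State) (x : Option M.Stack) : Derives M (.inl (p, x, p, x)) []
  | move {q p : M.State} {a : Option α} {x y : Option M.Stack} (h : (p, y) ∈ M.trans q a x) :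
      Derives M (.inl (q, x, p, y)) a.toList
  | frame {p q : M.State} {u : List α} (h : Derives M (.inl (p, none, q, none)) u)
      (x : Option M.Stack) : Derives M (.inl (p, x, q, x)) u
  | append {p q r : M.State} {x y z : Option M.Stack} {u v : List α}
      (hu : Derives M (.inl (p, x, q, y)) u) (hv : Derives M (.inl (q, y, r, z)) v) :
      Derives M (.inl (p, x, r, z)) (u ++ v)
  | init : Derives M (.inr M.start) []
  | extend {p q : M.State} {y : Option M.Stack} {u v : List α}
      (hu : Derives M (.inr p) u) (hv : Derives M (.inl (p, none, q, y)) v) :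
      Derives M (.inr q) (u ++ v)

/-- The intended meaning of the nonterminals in terms of runs of `M`. -/
def Realizes (M : PDA α) : M.Nonterminal → List α → Prop
  | .inl (p, x, q, y), u => ∀ (w : List α) (s : List M.Stack),
      Relation.ReflTransGen M.Step (p, u ++ w, x.toList ++ s) (q, w, y.toList ++ s)
  | .inr q, u => ∃ s : List M.Stack, ∀ w : List α,
      Relation.ReflTransGen M.Step (M.start, u ++ w, []) (q, w, s)

theorem Derives.realizes {M : PDA α} {A : M.Nonterminal} {u : List α} (h : M.Derives A u) :
    M.Realizes A u := by
  induction h with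
  | refl p x => exact fun w s => .refl
  | move h => exact fun w s => .single (.move h w s)
  | frame h x ih => exact fun w s => ih w (x.toList ++ s)
  | append hu hv ihu ihv =>
    intro w s
    rw [List.append_assoc]
    exact (ihu _ s).trans (ihv w s)
  | init => exact ⟨[], fun w => .refl⟩
  | @extend p q y u v hu hv ihu ihv =>
    obtain ⟨s, hs⟩ := ihu
    refine ⟨y.toList ++ s, fun w => ?_⟩
    rw [List.append_assoc]
    exact (hs _).trans (ihv w s)

/-- `M.Layered q u s`: the word `u` splits into the parts read at each level of the stack `s` of a
run from the initial configuration to state `q`. The part belonging to a stack symbol starts when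
its level was last empty, so that everything below the symbol is untouched since then. -/
inductive Layered (M : PDA α) : M.State → List α → List M.Stack → Prop
  | nil {q : M.State} {u : List α} (h : M.Derives (.inl (M.start, none, q, none)) u) :
      Layered M q u []
  | cons {r q : M.State} {u v : List α} {x : M.Stack} {s : List M.Stack}
      (hu : Layered M r u s) (hv : M.Derives (.inl (r, none, q, some x)) v) :
      Layered M q (u ++ v) (x :: s)

theorem Layered.extend {M : PDA α} {r q : M.State} {u v : List α} {s : List M.Stack}
    (h : M.Layered r u s) (hv : M.Derives (.inl (r, none, q, none)) v) :
    M.Layered q (u ++ v) s := by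
  cases h with
  | nil h => exact .nil (h.append hv)
  | cons hu h =>
    rw [List.append_assoc]
    exact .cons hu (h.append (hv.frame _))

theorem Layered.step {M : PDA α} {q p : M.State} {a : Option α} {x y : Option M.Stack}
    {u : List α} {s : List M.Stack} (h : M.Layered q u (x.toList ++ s))
    (hm : (p, y) ∈ M.trans q a x) : M.Layered p (u ++ a.toList) (y.toList ++ s) := by
  have hd := Derives.move hm
  rcases x with _ | x
  · rcases y with _ | y
    · exact h.extend hd
    · exact .cons h hd
  · cases h with
    | cons hu hv =>
      rcases y with _ | y
      · rw [List.append_assoc]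
        exact hu.extend (hv.append hd)
      · rw [List.append_assoc]
        exact .cons hu (hv.append hd)

theorem layered_of_reflTransGen {M : PDA α} {w : List α} {c : M.Config}
    (h : Relation.ReflTransGen M.Step (M.start, w, []) c) :
    ∃ u, w = u ++ c.2.1 ∧ M.Layered c.1 u c.2.2 := by
  induction h with
  | refl => exact ⟨[], rfl, .nil (.refl _ _)⟩
  | tail _ hs ih =>
    cases hs with
    | move hm v s =>
      obtain ⟨u, rfl, hu⟩ := ih
      exact ⟨_, (List.append_assoc _ _ _).symm, hu.step hm⟩

theorem Layered.derives {M : PDA α} {q : M.State} {u : List α} {s : List M.Stack}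
    (h : M.Layered q u s) : M.Derives (.inr q) u := by
  induction h with
  | nil h => exact .extend .init h
  | cons _ hv ih => exact .extend ih hv

theorem mem_language_iff_derives {M : PDA α} {w : List α} :
    w ∈ M.language ↔ ∃ q ∈ M.accept, M.Derives (.inr q) w := by
  constructor
  · rintro ⟨q, hq, s, h⟩
    obtain ⟨u, rfl, hu⟩ := layered_of_reflTransGen h
    exact ⟨q, hq, by simpa using hu.derives⟩
  · rintro ⟨q, hq, h⟩
    obtain ⟨s, hs⟩ := h.realizes
    exact ⟨q, hq, s, by simpa using hs []⟩

/-- A derived word of length at least `L` has a factor of length between `L` and `2 * L` that is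
generated by a single nonterminal `B` and may be replaced by any other word generated by `B`: walk
down the derivation tree, always into a subtree whose yield has at least `L` letters, until the
yield has at most `2 * L` letters. -/
theorem Derives.exists_factor {M : PDA α} {L : ℕ} (hL : 1 ≤ L) {A : M.Nonterminal} {w : List α}
    (h : M.Derives A w) (hw : L ≤ w.length) :
    ∃ B x u y, w = x ++ u ++ y ∧ L ≤ u.length ∧ u.length ≤ 2 * L ∧ M.Derives B u ∧
      ∀ u', M.Derives B u' → M.Derives A (x ++ u' ++ y) := by
  have whole : ∀ {A : M.Nonterminal} {w : List α}, M.Derives A w → L ≤ w.length →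
      w.length ≤ 2 * L → ∃ B x u y, w = x ++ u ++ y ∧ L ≤ u.length ∧ u.length ≤ 2 * L ∧
        M.Derives B u ∧ ∀ u', M.Derives B u' → M.Derives A (x ++ u' ++ y) :=
    fun {A w} h h1 h2 => ⟨A, [], w, [], by simp, h1, h2, h, by simp⟩
  induction h with
  | refl p x => exact whole (.refl p x) hw (by simp)
  | @move q p a x y h =>
    refine whole (.move h) hw ?_
    cases a <;> simp; omega
  | frame h x ih =>
    obtain ⟨B, l, u, r, e, h1, h2, h3, h4⟩ := ih hw
    exact ⟨B, l, u, r, e, h1, h2, h3, fun u' hu' => (h4 u' hu').frame x⟩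
  | init => exact whole .init hw (by simp)
  | @append p q r x y z u v hu hv ihu ihv =>
    by_cases hs : (u ++ v).length ≤ 2 * L
    · exact whole (hu.append hv) hw hs
    rw [List.length_append] at hs
    by_cases hul : L ≤ u.length
    · obtain ⟨B, l, t, r, rfl, h1, h2, h3, h4⟩ := ihu hul
      exact ⟨B, l, t, r ++ v, by simp, h1, h2, h3,
        fun u' hu' => by simpa using (h4 u' hu').append hv⟩
    · obtain ⟨B, l, t, r, rfl, h1, h2, h3, h4⟩ := ihv (by omega)
      exact ⟨B, u ++ l, t, r, by simp, h1, h2, h3,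
        fun u' hu' => by simpa using hu.append (h4 u' hu')⟩
  | @extend p q y u v hu hv ihu ihv =>
    by_cases hs : (u ++ v).length ≤ 2 * L
    · exact whole (hu.extend hv) hw hs
    rw [List.length_append] at hs
    by_cases hul : L ≤ u.length
    · obtain ⟨B, l, t, r, rfl, h1, h2, h3, h4⟩ := ihu hul
      exact ⟨B, l, t, r ++ v, by simp, h1, h2, h3,
        fun u' hu' => by simpa using (h4 u' hu').extend hv⟩
    · obtain ⟨B, l, t, r, rfl, h1, h2, h3, h4⟩ := ihv (by omega)
      exact ⟨B, u ++ l, t, r, by simp, h1, h2, h3,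
        fun u' hu' => by simpa using hu.extend (h4 u' hu')⟩

theorem card_nonterminal_le (M : PDA α) : Nat.card M.Nonterminal ≤ 2 * M.size ^ 4 := by
  have := M.finite_state
  have := M.finite_stack
  have hQ : 0 < Nat.card M.State := Nat.card_pos_iff.2 ⟨⟨M.start⟩, inferInstance⟩
  have h1 : Nat.card M.State ≤ M.size := Nat.le_add_right _ _
  have h2 : Nat.card M.Stack + 1 ≤ M.size := by unfold size; omega
  rw [Nat.card_sum, Nat.card_prod, Nat.card_prod, Nat.card_prod, Finite.card_option]
  calc _ ≤ M.size * (M.size * (M.size * M.size)) + M.size := by gcongr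
    _ ≤ M.size * (M.size * (M.size * M.size)) + M.size ^ 4 := by
        gcongr; exact Nat.le_self_pow (by norm_num) _
    _ = _ := by ring

end PDA

/-! ### Counting squares with exchangeable factors -/

theorem getElem?_append_self {α : Type*} {m : ℕ} {w : List α} (hw : w.length = m) {j : ℕ}
    (hj : j < 2 * m) : (w ++ w)[j]? = w[j % m]? := by
  rcases lt_or_ge j m with h | h
  · rw [List.getElem?_append_left (by omega), Nat.mod_eq_of_lt h]
  · rw [List.getElem?_append_right (by omega), Nat.mod_eq_sub_mod h, Nat.mod_eq_of_lt (by omega),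
      hw]

/-- In a square of length `2 * m`, a factor of length at most `m` is determined by the rest of the
word, since every letter has a copy at distance `m` outside the factor. -/
theorem eq_of_append_mem_squares {α : Type*} {m : ℕ} {x u u' y : List α}
    (h : x ++ u ++ y ∈ squares α m) (h' : x ++ u' ++ y ∈ squares α m)
    (hu : u'.length = u.length) (hum : u.length ≤ m) : u' = u := by
  obtain ⟨w, hw, e⟩ := h
  obtain ⟨v, hv, e'⟩ := h'
  have hlen := congrArg List.length e
  simp only [List.length_append, hw] at hlen
  have inside : ∀ (t : List α), t.length = u.length → ∀ i < u.length,
      (x ++ t ++ y)[x.length + i]? = t[i]? := fun t ht i hi => by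
    rw [List.append_assoc, List.getElem?_append_right (by omega),
      List.getElem?_append_left (by omega)]
    congr 1; omega
  have outside : ∀ j, (j < x.length ∨ x.length + u.length ≤ j) →
      (x ++ u' ++ y)[j]? = (x ++ u ++ y)[j]? := fun j hj => by
    rcases hj with hj | hj
    · rw [List.append_assoc, List.append_assoc, List.getElem?_append_left hj,
        List.getElem?_append_left hj]
    · rw [List.getElem?_append_right (by simp; omega), List.getElem?_append_right (by simp; omega)]
      simp [hu]
  refine List.ext_getElem? fun i => ?_
  rcases lt_or_ge i u.length with hi | hi
  · -- `j` is the position of the other copy of the letter; it lies outside the factor.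
    obtain ⟨j, hj, hjo, hjm⟩ : ∃ j < 2 * m, (j < x.length ∨ x.length + u.length ≤ j) ∧
        j % m = (x.length + i) % m := by
      rcases lt_or_ge (x.length + i) m with h | h
      · exact ⟨x.length + i + m, by omega, by omega, by simp⟩
      · exact ⟨x.length + i - m, by omega, by omega, (Nat.mod_eq_sub_mod h).symm⟩
    rw [← inside u' hu i hi, ← inside u rfl i hi, e', e,
      getElem?_append_self hw (by omega), getElem?_append_self hv (by omega), ← hjm,
      ← getElem?_append_self hw hj, ← getElem?_append_self hv hj, ← e, ← e', outside j hjo]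
  · rw [List.getElem?_eq_none (by omega), List.getElem?_eq_none hi]

/-- A set of words of length `m` that all agree on a cyclic interval of `l` positions has at most
`|α| ^ (m - l)` elements. -/
theorem card_le_of_agree_on_arc {α : Type*} [Fintype α] [DecidableEq α] {m i l : ℕ} (hl : l ≤ m)
    (S : Finset (Fin m → α))
    (hS : ∀ f ∈ S, ∀ g ∈ S, ∀ j (hm : 0 < m), i ≤ j → j < i + l →
      f ⟨j % m, Nat.mod_lt _ hm⟩ = g ⟨j % m, Nat.mod_lt _ hm⟩) :
    S.card ≤ Fintype.card α ^ (m - l) := by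
  classical
  rcases Nat.eq_zero_or_pos m with rfl | hm
  · simpa using Finset.card_le_univ S
  -- The positions in the interval; there are `l` of them because `l ≤ m`.
  let T : Finset (Fin m) := (Finset.Ico i (i + l)).image fun j => ⟨j % m, Nat.mod_lt _ hm⟩
  have hT : T.card = l := by
    rw [Finset.card_image_of_injOn, Nat.card_Ico, Nat.add_sub_cancel_left]
    intro a ha b hb hab
    simp only [Finset.coe_Ico, Set.mem_Ico] at ha hb
    have hab : a % m = b % m := by simpa using hab
    have hab : a ≡ b [MOD m] := hab
    rcases le_total a b with h | h
    · have := (Nat.modEq_iff_dvd' h).1 hab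
      have := Nat.eq_zero_of_dvd_of_lt this (by omega)
      omega
    · have := (Nat.modEq_iff_dvd' h).1 hab.symm
      have := Nat.eq_zero_of_dvd_of_lt this (by omega)
      omega
  let res : S → ({j // j ∉ T} → α) := fun f j => f.1 j.1
  have hinj : Function.Injective res := by
    rintro ⟨f, hf⟩ ⟨g, hg⟩ hfg
    refine Subtype.ext (funext fun j => ?_)
    by_cases hj : j ∈ T
    · obtain ⟨a, ha, rfl⟩ := Finset.mem_image.1 hj
      rw [Finset.mem_Ico] at ha
      exact hS f hf g hg a hm ha.1 ha.2
    · exact congrFun hfg ⟨j, hj⟩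
  have := Fintype.card_le_of_injective res hinj
  simpa [Fintype.card_subtype_compl, hT] using this

/-- An automaton for the squares of length `2 * m` has many nonterminals. Attach to each `f` of length
`m` the nonterminal, position and length of an exchangeable factor of `ff` with between `L` and
`2 * L ≤ m` letters. Words with equal data have equal factors, because exchanging the factors must
give a square again; so at most `|α| ^ (m - L)` words share the same data. -/
theorem PDA.pow_le_of_language_eq_squares {α : Type*} [Fintype α] [DecidableEq α] [Nonempty α]
    {L m : ℕ} (hL : 1 ≤ L) (hm : 2 * L ≤ m) (M : PDA α) (hM : M.language = squares α m) :
    Fintype.card α ^ L ≤ 2 * M.size ^ 4 * ((2 * m + 1) * (m + 1)) := by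
  classical
  have := M.finite_state
  have := M.finite_stack
  have : Fintype M.Nonterminal := Fintype.ofFinite _
  have key : ∀ f : Fin m → α, ∃ (k : M.Nonterminal × Fin (2 * m + 1) × Fin (m + 1)),
      ∃ x u y, List.ofFn f ++ List.ofFn f = x ++ u ++ y ∧ M.Derives k.1 u ∧
        x.length = k.2.1 ∧ u.length = k.2.2 ∧ L ≤ u.length ∧
        ∀ u', M.Derives k.1 u' → x ++ u' ++ y ∈ squares α m := by
    intro f
    have hf : List.ofFn f ++ List.ofFn f ∈ M.language := hM ▸ ⟨_, by simp, rfl⟩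
    obtain ⟨q, hq, hd⟩ := mem_language_iff_derives.1 hf
    obtain ⟨B, x, u, y, e, h1, h2, h3, h4⟩ := hd.exists_factor hL (by simp; omega)
    have hlen := congrArg List.length e
    simp only [List.length_append, List.length_ofFn] at hlen
    exact ⟨(B, ⟨x.length, by omega⟩, ⟨u.length, by omega⟩), x, u, y, e, h3, rfl, rfl, h1,
      fun u' hu' => hM ▸ mem_language_iff_derives.2 ⟨q, hq, h4 u' hu'⟩⟩
  choose K hK using key
  have fiber : ∀ k ∈ (Finset.univ : Finset (M.Nonterminal × Fin (2 * m + 1) × Fin (m + 1))),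
      (Finset.univ.filter fun f => K f = k).card ≤ Fintype.card α ^ (m - L) := by
    intro k _
    rcases (Finset.univ.filter fun f => K f = k).eq_empty_or_nonempty with h0 | ⟨f₀, hf₀⟩
    · simp [h0]
    have hLk : L ≤ (k.2.2 : ℕ) := by
      obtain ⟨x, u, y, -, -, -, hu, hLu, -⟩ := hK f₀
      rw [(Finset.mem_filter.1 hf₀).2] at hu
      omega
    have hkm : (k.2.2 : ℕ) ≤ m := by omega
    refine (card_le_of_agree_on_arc (i := k.2.1) hkm _ ?_).trans
      (Nat.pow_le_pow_right Fintype.card_pos (by omega))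
    intro f hf g hg j hm0 hj hj'
    obtain ⟨x, u, y, e, hu, hx, hul, -, hsw⟩ := hK f
    obtain ⟨x', u', y', e', hu', hx', hul', -, -⟩ := hK g
    rw [(Finset.mem_filter.1 hf).2] at hu hx hul hsw
    rw [(Finset.mem_filter.1 hg).2] at hu' hx' hul'
    -- The factor of `gg` is put into `ff`; the result is still accepted, hence a square.
    obtain rfl : u' = u := eq_of_append_mem_squares (hsw u hu) (hsw u' hu') (by omega) (by omega)
    have hlen := congrArg List.length e
    simp only [List.length_append, List.length_ofFn] at hlen
    have read : ∀ (h : Fin m → α) (x y : List α), List.ofFn h ++ List.ofFn h = x ++ u' ++ y →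
        x.length = k.2.1 → some (h ⟨j % m, Nat.mod_lt _ hm0⟩) = u'[j - k.2.1]? := by
      intro h x y e hx
      have : (List.ofFn h ++ List.ofFn h)[j]? = some (h ⟨j % m, Nat.mod_lt _ hm0⟩) := by
        rw [getElem?_append_self (m := m) (by simp) (by omega), List.getElem?_ofFn,
          dif_pos (Nat.mod_lt _ hm0)]
      rw [← this, e, List.append_assoc, List.getElem?_append_right (by omega),
        List.getElem?_append_left (by omega), hx]
    exact Option.some_injective _ ((read f x y e hx).trans (read g x' y' e' hx').symm)
  have hcount := Finset.card_le_mul_card_image_of_maps_to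
    (s := (Finset.univ : Finset (Fin m → α))) (fun f _ => Finset.mem_univ (K f)) _ fiber
  simp only [Finset.card_univ, Fintype.card_fun, Fintype.card_fin, Fintype.card_prod] at hcount
  have hN : Fintype.card M.Nonterminal ≤ 2 * M.size ^ 4 := by
    rw [← Nat.card_eq_fintype_card]; exact M.card_nonterminal_le
  have hsplit : Fintype.card α ^ m = Fintype.card α ^ (m - L) * Fintype.card α ^ L := by
    rw [← pow_add]; congr 1; omega
  rw [hsplit] at hcount
  refine (Nat.le_of_mul_le_mul_left hcount (pow_pos Fintype.card_pos _)).trans ?_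
  gcongr

/-! ### A small automaton for the words that are not squares -/

theorem length_of_mem_squares {α : Type*} {m : ℕ} {z : List α} (h : z ∈ squares α m) :
    z.length = 2 * m := by
  obtain ⟨w, hw, rfl⟩ := h
  simp [hw, two_mul]

theorem getElem?_add_of_mem_squares {α : Type*} {m i : ℕ} {z : List α} (h : z ∈ squares α m)
    (hi : i < m) : z[i + m]? = z[i]? := by
  obtain ⟨w, hw, rfl⟩ := h
  rw [getElem?_append_self hw (by omega), getElem?_append_self hw (by omega), Nat.add_mod_right]

theorem exists_append_cons {α : Type*} {i : ℕ} {u : List α} (h : i < u.length) :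
    ∃ x y, u = x ++ u[i] :: y ∧ x.length = i :=
  ⟨u.take i, u.drop (i + 1), by simp, by simp; omega⟩

theorem exists_mismatch_of_notMem_squares {α : Type*} {m : ℕ} {z : List α}
    (hz : z.length = 2 * m) (h : z ∉ squares α m) :
    ∃ x a y b v, z = x ++ a :: (y ++ b :: v) ∧ y.length + 1 = m ∧ a ≠ b := by
  obtain ⟨i, hi, hne⟩ : ∃ i, ∃ hi : i < m, z[i] ≠ z[i + m] := by
    by_contra! hcon
    refine h ⟨z.take m, by simp; omega, ?_⟩
    conv_lhs => rw [← List.take_append_drop m z]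
    congr 1
    refine List.ext_getElem (by simp; omega) fun i h1 h2 => ?_
    simp only [List.length_take, lt_inf_iff] at h2
    simpa [add_comm] using (hcon i h2.1).symm
  obtain ⟨x, t, ht, hx⟩ := exists_append_cons (show i < z.length by omega)
  have hlen := congrArg List.length ht
  simp only [List.length_append, List.length_cons] at hlen
  obtain ⟨y, v, hy, hyl⟩ := exists_append_cons (show m - 1 < t.length by omega)
  refine ⟨x, z[i], y, t[m - 1], v, by rw [← hy]; exact ht, by omega, fun hab => hne ?_⟩
  rw [hab]
  have : z[i + m]? = t[m - 1]? := by
    rw [ht, List.getElem?_append_right (by omega),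
      show i + m - x.length = (m - 1) + 1 by omega, List.getElem?_cons_succ]
  rw [List.getElem?_eq_getElem (by omega), List.getElem?_eq_getElem (by omega)] at this
  exact (Option.some_injective _ this).symm

/-- The states of `nonSquarePDA`. In `scan` the automaton looks for the first letter of a mismatch;
`count b j` reads `2 ^ j` letters and leads to `back b c`, where `c` is the code of the last letter
read; `full` is reached after exactly `2 ^ (n + 1)` letters, and `done` once the word read so far
cannot be completed to a square. The flag `b` is `true` when the length of the input is checked, and
`false` when the distance of two mismatched letters is counted. -/
inductive NonSquareState (n k : ℕ) : Type
  | start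
  | scan
  | full
  | done
  | count (b : Bool) (j : Fin (n + 2))
  | back (b : Bool) (c : Fin k)

/-- The stack symbols of `nonSquarePDA`: `block j` asks for `2 ^ j` further letters, and the last
symbol of the stack is `letter c`, the code of the first letter of the guessed mismatch, or `bottom`,
when the length of the input is checked. -/
inductive NonSquareSymbol (n k : ℕ) : Type
  | block (j : Fin (n + 2))
  | letter (c : Fin k)
  | bottom

open NonSquareState NonSquareSymbol

/-- An embedding into a type of known cardinality. -/
def NonSquareState.encode {n k : ℕ} :
    NonSquareState n k → Fin 4 ⊕ (Bool × Fin (n + 2)) ⊕ (Bool × Fin k)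
  | start => .inl 0
  | scan => .inl 1
  | full => .inl 2
  | done => .inl 3
  | count b j => .inr (.inl (b, j))
  | back b c => .inr (.inr (b, c))

theorem NonSquareState.encode_injective {n k : ℕ} :
    Function.Injective (encode : NonSquareState n k → _) := by
  intro p q h
  cases p <;> cases q <;> simp_all [encode]

/-- An embedding into a type of known cardinality. -/
def NonSquareSymbol.encode {n k : ℕ} : NonSquareSymbol n k → Option (Fin (n + 2) ⊕ Fin k)
  | block j => some (.inl j)
  | letter c => some (.inr c)
  | bottom => none

theorem NonSquareSymbol.encode_injective {n k : ℕ} :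
    Function.Injective (encode : NonSquareSymbol n k → _) := by
  intro p q h
  cases p <;> cases q <;> simp_all [encode]

/-- The moves of `nonSquarePDA`: `NonSquareMove n code q a x p y` leads from state `q` to `p`, reads
`a`, pops `x` and pushes `y`. -/
inductive NonSquareMove {α : Type*} (n : ℕ) {k : ℕ} (code : α → Fin k) :
    NonSquareState n k → Option α → Option (NonSquareSymbol n k) →
      NonSquareState n k → Option (NonSquareSymbol n k) → Prop
  | toScan : NonSquareMove n code start none none scan none
  | toCount : NonSquareMove n code start none none (count true ⟨n + 1, by omega⟩) (some bottom)
  | scan (a : α) : NonSquareMove n code scan (some a) none scan none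
  | guess (a : α) : NonSquareMove n code scan (some a) none (count false ⟨n, by omega⟩)
      (some (letter (code a)))
  | split (b : Bool) {i j : Fin (n + 2)} (h : (j : ℕ) = i + 1) :
      NonSquareMove n code (count b j) none none (count b i) (some (block i))
  | read (b : Bool) {j : Fin (n + 2)} (h : (j : ℕ) = 0) (a : α) :
      NonSquareMove n code (count b j) (some a) none (back b (code a)) none
  | resume (b : Bool) (c : Fin k) (j : Fin (n + 2)) :
      NonSquareMove n code (back b c) none (some (block j)) (count b j) none
  | mismatch {c d : Fin k} (h : c ≠ d) :
      NonSquareMove n code (back false c) none (some (letter d)) done none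
  | finish (c : Fin k) : NonSquareMove n code (back true c) none (some bottom) full none
  | overflow (a : α) : NonSquareMove n code full (some a) none done none
  | rest (a : α) : NonSquareMove n code done (some a) none done none

/-- The automaton for the words that are not squares of length `2 ^ (n + 1)`. The states
`count true j` are accepting because at least one of the `2 ^ (n + 1)` letters is still missing
there. The letters are coded in `Fin k` since states and stack symbols live in `Type`. -/
def nonSquarePDA {α : Type*} (n : ℕ) {k : ℕ} (code : α → Fin k) : PDA α where
  State := NonSquareState n k
  Stack := NonSquareSymbol n k
  finite_state := Finite.of_injective _ NonSquareState.encode_injective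
  finite_stack := Finite.of_injective _ NonSquareSymbol.encode_injective
  start := start
  accept := {q | q = done ∨ ∃ j, q = count true j}
  trans q a x := {r | NonSquareMove n code q a x r.1 r.2}

theorem nonSquarePDA_size_le {α : Type*} (n : ℕ) {k : ℕ} (code : α → Fin k) :
    (nonSquarePDA n code).size ≤ 3 * n + 11 + 3 * k := by
  have h1 : Nat.card (NonSquareState n k) ≤ 4 + (2 * (n + 2) + 2 * k) := by
    simpa using Nat.card_le_card_of_injective _ (NonSquareState.encode_injective (n := n) (k := k))
  have h2 : Nat.card (NonSquareSymbol n k) ≤ n + 2 + k + 1 := by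
    simpa using Nat.card_le_card_of_injective _ (NonSquareSymbol.encode_injective (n := n) (k := k))
  change Nat.card (NonSquareState n k) + Nat.card (NonSquareSymbol n k) ≤ _
  omega

/-- `NonSquarePending code b z u r`: after reading `u`, with `z` at the end of the stack, `r` letters
are still to be counted: up to the length `2 ^ (n + 1)`, or up to distance `2 ^ n` from the letter
recorded in `z`. -/
def NonSquarePending {α : Type*} {n k : ℕ} (code : α → Fin k) :
    Bool → NonSquareSymbol n k → List α → ℕ → Prop
  | true, z, u, r => z = bottom ∧ u.length + r = 2 * 2 ^ n
  | false, z, u, r => ∃ x a y, z = letter (code a) ∧ u = x ++ a :: y ∧ y.length + r = 2 ^ n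

theorem NonSquarePending.read {α : Type*} {n k r : ℕ} {code : α → Fin k} {b : Bool}
    {z : NonSquareSymbol n k} {u : List α} (h : NonSquarePending code b z u (r + 1)) (a : α) :
    NonSquarePending code b z (u ++ [a]) r := by
  cases b with
  | true => exact ⟨h.1, by rw [List.length_append, ← h.2]; simp; omega⟩
  | false =>
    obtain ⟨x, c, y, rfl, rfl, h⟩ := h
    exact ⟨x, c, y ++ [a], rfl, by simp, by rw [List.length_append, ← h]; simp; omega⟩

/-- What holds in state `q` with stack `s` after reading `u`, in every run of `nonSquarePDA`. -/
def NonSquareInvariant {α : Type*} {n k : ℕ} (code : α → Fin k) :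
    NonSquareState n k → List α → List (NonSquareSymbol n k) → Prop
  | start, u, s => u = [] ∧ s = []
  | scan, _, s => s = []
  | full, u, s => s = [] ∧ u.length = 2 * 2 ^ n
  | done, u, _ => ∀ v, u ++ v ∉ squares α (2 ^ n)
  | count b j, u, s => ∃ (js : List (Fin (n + 2))) (z : NonSquareSymbol n k),
      s = js.map block ++ [z] ∧
        NonSquarePending code b z u ((js.map fun i : Fin (n + 2) => 2 ^ (i : ℕ)).sum + 2 ^ (j : ℕ))
  | back b c, u, s => (∃ (js : List (Fin (n + 2))) (z : NonSquareSymbol n k),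
      s = js.map block ++ [z] ∧
        NonSquarePending code b z u (js.map fun i : Fin (n + 2) => 2 ^ (i : ℕ)).sum) ∧
      ∃ y a, u = y ++ [a] ∧ code a = c

theorem NonSquareInvariant.move {α : Type*} {n k : ℕ} {code : α → Fin k}
    {q p : NonSquareState n k} {a : Option α} {x y : Option (NonSquareSymbol n k)} {u : List α}
    {s : List (NonSquareSymbol n k)} (h : NonSquareInvariant code q u (x.toList ++ s))
    (hm : NonSquareMove n code q a x p y) :
    NonSquareInvariant code p (u ++ a.toList) (y.toList ++ s) := by
  cases hm with
  | toScan => exact h.2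
  | toCount =>
    obtain ⟨rfl, hs⟩ := h
    obtain rfl : s = [] := hs
    exact ⟨[], bottom, rfl, rfl, by simp [pow_succ, mul_comm]⟩
  | scan a => exact h
  | guess a =>
    obtain rfl : s = [] := h
    exact ⟨[], _, rfl, u, a, [], rfl, rfl, by simp⟩
  | @split b i j hij =>
    obtain ⟨js, z, hs, hp⟩ := h
    obtain rfl : s = js.map block ++ [z] := hs
    refine ⟨i :: js, z, rfl, ?_⟩
    rw [hij, pow_succ] at hp
    simp only [Option.toList_none, List.append_nil, List.map_cons, List.sum_cons]
    convert hp using 1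
    ring
  | read b hj a =>
    obtain ⟨js, z, hs, hp⟩ := h
    rw [hj, pow_zero] at hp
    exact ⟨⟨js, z, hs, hp.read a⟩, u, a, rfl, rfl⟩
  | resume b c j =>
    obtain ⟨⟨js, z, hs, hp⟩, -⟩ := h
    cases js with
    | nil =>
      obtain ⟨rfl, -⟩ : block j = z ∧ s = [] := by simpa using hs
      cases b with
      | true => cases hp.1
      | false => obtain ⟨x, a, y, hz, -⟩ := hp; cases hz
    | cons i js =>
      obtain ⟨rfl, rfl⟩ : j = i ∧ s = js.map block ++ [z] := by simpa using hs
      refine ⟨js, z, rfl, ?_⟩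
      simpa [add_comm] using hp
  | @mismatch c d hcd =>
    obtain ⟨⟨js, z, hs, x, e, y, rfl, rfl, hy⟩, t, a, hu, rfl⟩ := h
    cases js with
    | cons i js => simp at hs
    | nil =>
      obtain ⟨rfl, -⟩ : d = code e ∧ s = [] := by simpa using hs
      have hpos : 0 < 2 ^ n := by positivity
      simp only [List.map_nil, List.sum_nil, add_zero] at hy
      rcases List.eq_nil_or_concat y with rfl | ⟨y, b, rfl⟩
      · simp at hy
        omega
      obtain rfl : b = a := by
        have := congrArg List.getLast? hu
        simpa [List.getLast?_append, List.getLast?_cons] using this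
      intro v hv
      simp only [List.concat_eq_append, List.length_append, List.length_singleton] at hy
      have hlen := length_of_mem_squares hv
      simp only [Option.toList_none, List.concat_eq_append, List.length_append,
        List.length_cons, List.length_nil] at hlen
      have heq := getElem?_add_of_mem_squares hv (i := x.length) (by omega)
      rw [show x ++ e :: y.concat b ++ (none : Option α).toList ++ v
        = x ++ ((e :: y) ++ b :: v) by simp] at heq
      have hblock : (e :: y).length = 2 ^ n := by
        rw [List.length_cons]
        omega
      rw [List.getElem?_append_right (by omega), List.getElem?_append_right (by omega),
        List.getElem?_append_right (by omega), Nat.add_sub_cancel_left, hblock, Nat.sub_self,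
        Nat.sub_self] at heq
      simp at heq
      exact hcd (by rw [heq])
  | finish c =>
    obtain ⟨⟨js, z, hs, rfl, hu⟩, -⟩ := h
    cases js with
    | cons i js => simp at hs
    | nil => exact ⟨by simpa using hs, by simpa using hu⟩
  | overflow a =>
    obtain ⟨-, hu⟩ := h
    intro v hv
    have := length_of_mem_squares hv
    simp at this
    omega
  | rest a => exact fun v hv => h (a :: v) (by simpa using hv)

theorem nonSquarePDA_run_invariant {α : Type*} {n k : ℕ} {code : α → Fin k} {w : List α}
    {c : (nonSquarePDA n code).Config}
    (h : Relation.ReflTransGen (nonSquarePDA n code).Step (start, w, []) c) :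
    ∃ u, w = u ++ c.2.1 ∧ NonSquareInvariant code c.1 u c.2.2 := by
  induction h with
  | refl => exact ⟨[], rfl, rfl, rfl⟩
  | tail _ hs ih =>
    cases hs with
    | move hm v s =>
      obtain ⟨u, rfl, hu⟩ := ih
      exact ⟨_, (List.append_assoc _ _ _).symm, hu.move hm⟩

section Runs

variable {α : Type*} {n k : ℕ} {code : α → Fin k}

theorem nonSquarePDA_step {q p : NonSquareState n k} {a : Option α}
    {x y : Option (NonSquareSymbol n k)} (h : NonSquareMove n code q a x p y) (w : List α)
    (s : List (NonSquareSymbol n k)) :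
    Relation.ReflTransGen (nonSquarePDA n code).Step (q, a.toList ++ w, x.toList ++ s)
      (p, w, y.toList ++ s) :=
  .single (.move (M := nonSquarePDA n code) h w s)

theorem nonSquarePDA_scan (u v : List α) (s : List (NonSquareSymbol n k)) :
    Relation.ReflTransGen (nonSquarePDA n code).Step (scan, u ++ v, s) (scan, v, s) := by
  induction u with
  | nil => exact .refl
  | cons a u ih => exact (nonSquarePDA_step (.scan a) _ s).trans ih

theorem nonSquarePDA_done (u v : List α) (s : List (NonSquareSymbol n k)) :
    Relation.ReflTransGen (nonSquarePDA n code).Step (done, u ++ v, s) (done, v, s) := by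
  induction u with
  | nil => exact .refl
  | cons a u ih => exact (nonSquarePDA_step (.rest a) _ s).trans ih

theorem nonSquarePDA_count (b : Bool) : ∀ (j : ℕ) (hj : j < n + 2) (u : List α) (a : α)
    (v : List α) (s : List (NonSquareSymbol n k)), u.length + 1 = 2 ^ j →
    Relation.ReflTransGen (nonSquarePDA n code).Step (count b ⟨j, hj⟩, u ++ a :: v, s)
      (back b (code a), v, s)
  | 0, hj, u, a, v, s, hu => by
    obtain rfl : u = [] := List.length_eq_zero_iff.1 (by simpa using hu)
    exact nonSquarePDA_step (.read b rfl a) v s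
  | j + 1, hj, u, a, v, s, hu => by
    rw [pow_succ] at hu
    have hpos : 0 < 2 ^ j := by positivity
    obtain ⟨x, y, e, hx⟩ := exists_append_cons (show 2 ^ j - 1 < u.length by omega)
    have hlen := congrArg List.length e
    simp only [List.length_append, List.length_cons] at hlen
    generalize u[2 ^ j - 1] = c at e
    subst e
    rw [List.append_assoc, List.cons_append]
    exact ((nonSquarePDA_step (.split b (i := ⟨j, by omega⟩) rfl) _ s).trans
      (nonSquarePDA_count b j (by omega) x c _ _ (by omega))).trans
      ((nonSquarePDA_step (.resume b _ _) _ s).trans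
        (nonSquarePDA_count b j (by omega) y a v s (by omega)))

theorem nonSquarePDA_count_partial (b : Bool) : ∀ (j : ℕ) (hj : j < n + 2) (u v : List α)
    (s : List (NonSquareSymbol n k)), u.length < 2 ^ j →
    ∃ i s', Relation.ReflTransGen (nonSquarePDA n code).Step (count b ⟨j, hj⟩, u ++ v, s)
      (count b i, v, s')
  | 0, hj, u, v, s, hu => by
    obtain rfl : u = [] := List.length_eq_zero_iff.1 (by simpa using hu)
    exact ⟨_, _, .refl⟩
  | j + 1, hj, u, v, s, hu => by
    rw [pow_succ] at hu
    have hpos : 0 < 2 ^ j := by positivity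
    have hsplit := fun w => nonSquarePDA_step (code := code)
      (.split b (i := ⟨j, by omega⟩) (j := ⟨j + 1, hj⟩) rfl) w s
    rcases lt_or_ge u.length (2 ^ j) with h | h
    · obtain ⟨i, s', hr⟩ := nonSquarePDA_count_partial b j (by omega) u v _ h
      exact ⟨i, s', (hsplit _).trans hr⟩
    · obtain ⟨x, y, e, hx⟩ := exists_append_cons (show 2 ^ j - 1 < u.length by omega)
      have hlen := congrArg List.length e
      simp only [List.length_append, List.length_cons] at hlen
      generalize u[2 ^ j - 1] = c at e
      subst e
      obtain ⟨i, s', hr⟩ := nonSquarePDA_count_partial b j (by omega) y v s (by omega)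
      rw [List.append_assoc, List.cons_append]
      exact ⟨i, s', ((hsplit _).trans
        (nonSquarePDA_count b j (by omega) x c _ _ (by omega))).trans
        ((nonSquarePDA_step (.resume b _ _) _ s).trans hr)⟩

end Runs

theorem nonSquarePDA_language {α : Type*} {n k : ℕ} {code : α → Fin k}
    (hcode : Function.Injective code) :
    (nonSquarePDA n code).language = scaledNonSquares α n := by
  ext z
  change z ∈ (nonSquarePDA n code).language ↔ z ∉ squares α (2 ^ n)
  constructor
  · rintro ⟨q, hq, s, h⟩ hz
    obtain ⟨u, rfl, hu⟩ := nonSquarePDA_run_invariant h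
    rcases hq with rfl | ⟨j, rfl⟩
    · exact hu [] hz
    · obtain ⟨js, y, -, -, hlen⟩ := hu
      have := length_of_mem_squares hz
      have hpos : 0 < 2 ^ (j : ℕ) := by positivity
      simp at this
      omega
  · intro hz
    have htop : (2 : ℕ) ^ (n + 1) = 2 * 2 ^ n := by ring
    have hpos : 0 < 2 ^ n := by positivity
    rcases lt_trichotomy z.length (2 * 2 ^ n) with h | h | h
    · obtain ⟨i, s, hr⟩ := nonSquarePDA_count_partial (n := n) (code := code) true (n + 1)
        (by omega) z [] [bottom] (by omega)
      rw [List.append_nil] at hr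
      exact ⟨count true i, .inr ⟨i, rfl⟩, s, (nonSquarePDA_step .toCount z []).trans hr⟩
    · obtain ⟨x, a, y, b, v, rfl, hy, hab⟩ := exists_mismatch_of_notMem_squares h hz
      refine ⟨done, .inl rfl, [], ?_⟩
      have hend := nonSquarePDA_done (n := n) (code := code) v [] []
      rw [List.append_nil] at hend
      exact (nonSquarePDA_step .toScan _ []).trans <| (nonSquarePDA_scan x _ []).trans <|
        (nonSquarePDA_step (.guess a) _ []).trans <|
        (nonSquarePDA_count false n (by omega) y b v _ hy).trans <|
        (nonSquarePDA_step (.mismatch fun e => hab (hcode e).symm) v []).trans hend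
    · obtain ⟨x, t, e, hx⟩ := exists_append_cons (show 2 * 2 ^ n - 1 < z.length by omega)
      have hlen := congrArg List.length e
      simp only [List.length_append, List.length_cons] at hlen
      generalize z[2 * 2 ^ n - 1] = a at e
      subst e
      cases t with
      | nil => simp at hlen h; omega
      | cons b v =>
        refine ⟨done, .inl rfl, [], ?_⟩
        have hend := nonSquarePDA_done (n := n) (code := code) v [] []
        rw [List.append_nil] at hend
        exact (nonSquarePDA_step .toCount _ []).trans <|
          (nonSquarePDA_count true (n + 1) (by omega) x a _ _ (by omega)).trans <|
          (nonSquarePDA_step (.finish _) _ []).trans <|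
          (nonSquarePDA_step (.overflow b) v []).trans hend

/-! ### Finite languages -/

/-- An automaton for a language of words of length at most `B`: the state is the word read so far,
coded in `Fin k` so that the states live in `Type`, and the stack is not used. -/
def prefixPDA {α : Type*} {k : ℕ} (code : α ≃ Fin k) (B : ℕ) (L : Language α) : PDA α where
  State := {l : List (Fin k) // l.length ≤ B}
  Stack := Empty
  finite_state := (List.finite_length_le (Fin k) B).to_subtype
  finite_stack := inferInstance
  start := ⟨[], Nat.zero_le _⟩
  accept := {q | q.1.map code.symm ∈ L}
  trans q a _ := {r | r.1.1 = q.1 ++ a.toList.map code ∧ r.2 = none}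

theorem prefixPDA_language {α : Type*} {k : ℕ} (code : α ≃ Fin k) {B : ℕ} {L : Language α}
    (hL : ∀ w ∈ L, w.length ≤ B) : (prefixPDA code B L).language = L := by
  ext w
  constructor
  · rintro ⟨q, hq, s, h⟩
    have inv : ∀ c : (prefixPDA code B L).Config,
        Relation.ReflTransGen (prefixPDA code B L).Step ((prefixPDA code B L).start, w, []) c →
        w = c.1.1.map code.symm ++ c.2.1 := by
      intro c hc
      induction hc with
      | refl => rfl
      | tail _ hs ih =>
        cases hs with
        | @move q p a x y hm v s =>
          rw [ih, hm.1]
          cases a <;> simp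
    have := inv _ h
    rw [List.append_nil] at this
    exact this ▸ hq
  · intro hw
    have run : ∀ (v u : List α) (hu : (u.map code).length ≤ B) (huv : u ++ v = w),
        Relation.ReflTransGen (prefixPDA code B L).Step (⟨u.map code, hu⟩, v, [])
          (⟨w.map code, by simpa using hL w hw⟩, [], []) := by
      intro v
      induction v with
      | nil =>
        intro u hu huv
        obtain rfl : u = w := by simpa using huv
        exact .refl
      | cons a v ih =>
        intro u hu huv
        have hB := hL w hw
        have hu' : ((u ++ [a]).map code).length ≤ B := by
          have := congrArg List.length huv
          simp at this ⊢
          omega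
        refine .head ?_ (ih (u ++ [a]) hu' (by simpa using huv))
        exact PDA.Step.move (M := prefixPDA code B L) (a := some a) (x := none) (y := none)
          (q := ⟨u.map code, hu⟩) (p := ⟨(u ++ [a]).map code, hu'⟩) ⟨by simp, rfl⟩ v []
    refine ⟨⟨w.map code, by simpa using hL w hw⟩, ?_, [], run w [] (Nat.zero_le _) rfl⟩
    change (w.map code).map code.symm ∈ L
    simpa using hw

/-! ### The bounds -/

theorem four_mul_add_eight_le_two_pow {n : ℕ} (hn : 8 ≤ n) : 4 * n + 8 ≤ 2 ^ (n - 1) := by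
  induction n, hn using Nat.le_induction with
  | base => norm_num
  | succ n hn ih =>
    have : 2 ^ (n + 1 - 1) = 2 * 2 ^ (n - 1) := by rw [← pow_succ']; congr 1; omega
    omega

/-- With `t = 2 ^ (n / 2)`, a size `z < 2 ^ t` would give `2 ^ (t ^ 2 / 2) < 2 ^ (4 + 2 * n + 4 * t)`,
which is impossible as `t ^ 2` outgrows both `n` and `t`. -/
theorem size_bound_of_pow_le {n z : ℕ} (hn : 8 ≤ n)
    (h : 2 ^ 2 ^ (n - 1) ≤ 2 * z ^ 4 * ((2 * 2 ^ n + 1) * (2 ^ n + 1))) :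
    (2 : ℝ) ^ ((2 : ℝ) ^ ((1 / 2 : ℝ) * n)) ≤ z := by
  set t : ℝ := (2 : ℝ) ^ ((1 / 2 : ℝ) * n) with ht
  have htt : t ^ 2 = 2 ^ n := by
    rw [ht, ← Real.rpow_natCast, ← Real.rpow_mul (by norm_num), ← Real.rpow_natCast]
    congr 1
    push_cast
    ring
  have hpow := four_mul_add_eight_le_two_pow hn
  have hhalf : (2 : ℝ) * 2 ^ (n - 1) = 2 ^ n := by
    rw [← pow_succ']; congr 1; omega
  have hpow' : (4 : ℝ) * n + 8 ≤ 2 ^ (n - 1) := by exact_mod_cast hpow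
  have ht16 : 16 ≤ t := by
    have : (16 : ℝ) ^ 2 ≤ t ^ 2 := by
      rw [htt]
      calc (16 : ℝ) ^ 2 = 2 ^ 8 := by norm_num
        _ ≤ 2 ^ n := pow_le_pow_right₀ (by norm_num) hn
    exact le_of_sq_le_sq this (by positivity)
  by_contra! hz
  have hexp : (2 : ℝ) ^ ((4 : ℝ) + n * 2 + t * 4) = 2 ^ 4 * (2 ^ n) ^ 2 * ((2 : ℝ) ^ t) ^ 4 := by
    rw [Real.rpow_add two_pos, Real.rpow_add two_pos, Real.rpow_mul two_pos.le,
      Real.rpow_mul two_pos.le, Real.rpow_natCast, Real.rpow_ofNat, Real.rpow_ofNat,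
      Real.rpow_ofNat]
  have hlin : ((2 : ℝ) * 2 ^ n + 1) * (2 ^ n + 1) ≤ 8 * (2 ^ n) ^ 2 := by
    have hm : (1 : ℝ) ≤ 2 ^ n := one_le_pow₀ (by norm_num)
    nlinarith
  have hkey : (2 : ℝ) ^ (2 ^ (n - 1) : ℝ) < 2 ^ ((4 : ℝ) + n * 2 + t * 4) := by
    calc (2 : ℝ) ^ (2 ^ (n - 1) : ℝ) = 2 ^ 2 ^ (n - 1) := by
          rw [← Real.rpow_natCast 2 (2 ^ (n - 1)), Nat.cast_pow, Nat.cast_ofNat]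
      _ ≤ 2 * z ^ 4 * ((2 * 2 ^ n + 1) * (2 ^ n + 1)) := by exact_mod_cast h
      _ ≤ 2 * z ^ 4 * (8 * (2 ^ n) ^ 2) := by gcongr
      _ < 2 * ((2 : ℝ) ^ t) ^ 4 * (8 * (2 ^ n) ^ 2) := by gcongr
      _ = 2 ^ ((4 : ℝ) + n * 2 + t * 4) := by rw [hexp]; ring
  have hlt := (Real.rpow_lt_rpow_left_iff (by norm_num)).1 hkey
  nlinarith

theorem mainTheorem7 (α : Type*) [Finite α] [Nontrivial α] :
    ∃ c : ℝ, 0 < c ∧ ∃ C : ℝ, 0 < C ∧ ∀ᶠ n : ℕ in Filter.atTop,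
      {x : List α | x ∉ scaledNonSquares α n}.Finite ∧
      IsPDALanguage (scaledNonSquares α n) ∧
      IsPDALanguage (scaledNonSquares α n)ᶜ ∧
      (∀ M : PDA α, M.language = (scaledNonSquares α n)ᶜ →
        (2 : ℝ) ^ ((2 : ℝ) ^ (c * (n : ℝ))) ≤ (M.size : ℝ)) ∧
      (∃ M : PDA α, M.language = scaledNonSquares α n ∧ (M.size : ℝ) ≤ C * (n : ℝ)) := by
  classical
  have := Fintype.ofFinite α
  obtain ⟨k, ⟨code⟩⟩ := Finite.exists_equiv_fin α
  refine ⟨1 / 2, by norm_num, 14 + 3 * k, by positivity,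
    (Filter.eventually_ge_atTop 8).mono fun n hn => ?_⟩
  have hcompl : (scaledNonSquares α n)ᶜ = squares α (2 ^ n) := compl_compl _
  rw [hcompl]
  refine ⟨?_, ⟨_, nonSquarePDA_language code.injective⟩,
    ⟨_, prefixPDA_language code fun w hw => (length_of_mem_squares hw).le⟩, fun M hM => ?_,
    nonSquarePDA n code, nonSquarePDA_language code.injective, ?_⟩
  · refine (List.finite_length_le α (2 * 2 ^ n)).subset fun x hx => ?_
    exact (length_of_mem_squares (not_not.1 hx)).le
  · -- `m = 2 ^ n` and `L = m / 2`, the largest choice for which the factors fit into one half.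
    have h2 : 2 * 2 ^ (n - 1) ≤ 2 ^ n := by
      rw [← pow_succ']
      exact Nat.pow_le_pow_right (by norm_num) (by omega)
    exact size_bound_of_pow_le hn ((Nat.pow_le_pow_left Fintype.one_lt_card _).trans
      (M.pow_le_of_language_eq_squares Nat.one_le_two_pow h2 hM))
  · have h1 : ((nonSquarePDA n code).size : ℝ) ≤ 3 * n + 11 + 3 * k := by
      exact_mod_cast nonSquarePDA_size_le n code
    have h2 : (1 : ℝ) ≤ n := by exact_mod_cast (by omega : 1 ≤ n)
    nlinarith [mul_nonneg (Nat.cast_nonneg (α := ℝ) k) (sub_nonneg.2 h2)]
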